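/- Let $D \ge 2$. Let $\mathbb{H}_1$ be the set of symmetric positive semidefinite matrices $\mathbf{Q}\in\mathbb{R}^{D\times D}$ with $\operatorname{tr}(\mathbf{Q})=1$, and let $\|\cdot\|_F$ and $\|\cdot\|$ denote the Frobenius and spectral norms of matrices (and $\|\cdot\|$ the Euclidean norm of vectors). For a data set $\mathcal{X}=\{\mathbf{x}_i\}_{i=1}^N\subset\mathbb{R}^D$ define $$\gamma_0(\mathcal{X})=\frac1N\min_{\mathbf{Q}\in\mathbb{H}_1,\ \boldsymbol{\Delta}=\boldsymbol{\Delta}^T,\ \|\boldsymbol{\Delta}\|_F=1,\ \operatorname{tr}(\boldsymbol{\Delta})=0}\ \sum_{i=1}^N\frac{\|\boldsymbol{\Delta}\mathbf{x}_i\|^2\|\mathbf{Q}\mathbf{x}_i\|^2-(\mathbf{x}_i^T\boldsymbol{\Delta}\mathbf{Q}\mathbf{x}_i)^2}{\|\mathbf{Q}\mathbf{x}_i\|^3},$$ where the $i$th term is set to $0$ when $\mathbf{Q}\mathbf{x}_i=\mathbf{0}$, and define $\gamma_0'(\mathcal{X})$ in the same way with the constraint $\|\boldsymbol{\Delta}\|_F=1$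 replaced by $\|\boldsymbol{\Delta}\|=1$. Let $\mu$ be a Borel probability measure on $\mathbb{R}^D$ with bounded support such that $\mu(\mathrm{L}_1)+\mu(\mathrm{L}_2)<1$ for any two distinct $(D-1)$-dimensional linear subspaces $\mathrm{L}_1,\mathrm{L}_2$ of $\mathbb{R}^D$. Then there exist constants $c_0(\mu)>0$ and $c_0'(\mu)>0$, depending only on $\mu$, such that, if $\mathbf{x}_1,\mathbf{x}_2,\dots$ are i.i.d. random vectors with distribution $\mu$ and $\mathcal{X}_N=\{\mathbf{x}_i\}_{i=1}^N$, then almost surely $$\liminf_{N\to\infty}\gamma_0(\mathcal{X}_N)\ge c_0(\mu)\quad\text{and}\quad\liminf_{N\to\infty}\gamma_0'(\mathcal{X}_N)\ge c_0'(\mu).$$ -/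

import Mathlib

open MeasureTheory ProbabilityTheory Filter

noncomputable section

namespace GMS

/-- The symmetric real `D × D` matrices of trace one. -/
def H (D : ℕ) : Set (Matrix (Fin D) (Fin D) ℝ) :=
  {Q | Q.IsSymm ∧ Q.trace = 1}

/-- The positive semidefinite members of `H D`. -/
def H₁ (D : ℕ) : Set (Matrix (Fin D) (Fin D) ℝ) :=
  {Q | Q ∈ H D ∧ Q.PosSemidef}

/-- The product `A x` of a matrix with a vector of Euclidean space. -/
def act {D : ℕ} (A : Matrix (Fin D) (Fin D) ℝ) (x : EuclideanSpace ℝ (Fin D)) :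
    EuclideanSpace ℝ (Fin D) :=
  WithLp.toLp 2 (A.mulVec x.ofLp)

/-- The Frobenius norm. -/
def frobeniusNorm {D : ℕ} (A : Matrix (Fin D) (Fin D) ℝ) : ℝ :=
  Real.sqrt (∑ i, ∑ j, A i j ^ 2)

/-- The spectral norm: the operator norm for the Euclidean norm. -/
def spectralNorm {D : ℕ} (A : Matrix (Fin D) (Fin D) ℝ) : ℝ :=
  ‖Matrix.toEuclideanCLM (n := Fin D) (𝕜 := ℝ) A‖

/-- The summand `(‖Δx‖² ‖Qx‖² - (xᵀΔQx)²) / ‖Qx‖³`, that is, the second derivative at `t = 0`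
of `‖(Q + tΔ)x‖` when `Qx ≠ 0`. It is `0` when `Qx = 0`, because of `a / 0 = 0`. -/
def secondDerivTerm {D : ℕ} (Q Δ : Matrix (Fin D) (Fin D) ℝ)
    (x : EuclideanSpace ℝ (Fin D)) : ℝ :=
  (‖act Δ x‖ ^ 2 * ‖act Q x‖ ^ 2 - inner ℝ x (act (Δ * Q) x) ^ 2) / ‖act Q x‖ ^ 3

/-- The pairs `(Q, Δ)` with `Q` positive semidefinite of trace one and `Δ` a direction of `H D`
(symmetric and of trace zero) which is normalized by `nrm Δ = 1`. -/
def feasible {D : ℕ} (nrm : Matrix (Fin D) (Fin D) ℝ → ℝ) :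
    Set (Matrix (Fin D) (Fin D) ℝ × Matrix (Fin D) (Fin D) ℝ) :=
  {p | p.1 ∈ H₁ D ∧ p.2.IsSymm ∧ nrm p.2 = 1 ∧ p.2.trace = 0}

/-- `(1 / N)` times the minimum over the feasible pairs of the sum of the second derivative terms.
For `2 ≤ D` the set of values is nonempty and bounded below by `0` (Cauchy-Schwarz inequality),
and its infimum is attained, since the sum is lower semicontinuous on a compact set. -/
def rscConstant {D N : ℕ} (nrm : Matrix (Fin D) (Fin D) ℝ → ℝ)
    (x : Fin N → EuclideanSpace ℝ (Fin D)) : ℝ :=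
  (1 / (N : ℝ)) * sInf ((fun p => ∑ i, secondDerivTerm p.1 p.2 (x i)) '' feasible nrm)

/-- The constant `γ₀` of a data set: the directions are normalized in the Frobenius norm. -/
def γ₀ {D N : ℕ} (x : Fin N → EuclideanSpace ℝ (Fin D)) : ℝ :=
  rscConstant frobeniusNorm x

/-- The constant `γ₀'` of a data set: the directions are normalized in the spectral norm. -/
def γ₀' {D N : ℕ} (x : Fin N → EuclideanSpace ℝ (Fin D)) : ℝ :=
  rscConstant spectralNorm x

end GMS

end

namespace GMS

variable {D : ℕ}

/-! The numerator of each summand, `gramDefect`, is the Gram determinant of `Qx` and `Δx`; unlike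
the quotient, it is continuous even where `Qx = 0`. On the bounded support `‖Qx‖ ≤ M`, so dividing
it by `M ^ 3` bounds the summand from below. Its mean is positive for every feasible pair: otherwise
μ would live on its zero set, which lies in two proper subspaces
(`exists_submodules_of_gramDefect`), against the hypothesis on μ (`not_ae_mem_or_mem`). The feasible
set is compact, so a uniform law of large numbers turns pointwise positivity into one constant. Of
the norm, only continuity, homogeneity and domination of the entries are used, so both cases follow
at once. -/

lemma smul_act (c : ℝ) (A : Matrix (Fin D) (Fin D) ℝ) (x : EuclideanSpace ℝ (Fin D)) :
    act (c • A) x = c • act A x := by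
  simp [act, Matrix.smul_mulVec]

lemma zero_act (x : EuclideanSpace ℝ (Fin D)) : act 0 x = 0 := by
  simp [act]

lemma inner_act_left {A : Matrix (Fin D) (Fin D) ℝ} (hA : A.IsSymm)
    (x y : EuclideanSpace ℝ (Fin D)) : inner ℝ (act A x) y = inner ℝ x (act A y) := by
  simp only [act, EuclideanSpace.inner_eq_star_dotProduct, star_trivial]
  rw [Matrix.dotProduct_mulVec, ← Matrix.mulVec_transpose, hA.eq, dotProduct_comm]

lemma act_mul (A B : Matrix (Fin D) (Fin D) ℝ) (x : EuclideanSpace ℝ (Fin D)) :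
    act (A * B) x = act A (act B x) := by
  simp [act, Matrix.mulVec_mulVec]

lemma eq_of_act_eq {A B : Matrix (Fin D) (Fin D) ℝ} (h : ∀ x, act A x = act B x) : A = B := by
  apply (Matrix.toEuclideanCLM (n := Fin D) (𝕜 := ℝ)).injective
  ext1 x
  exact h x

lemma continuous_act {T : Type*} [TopologicalSpace T] {A : T → Matrix (Fin D) (Fin D) ℝ}
    {x : T → EuclideanSpace ℝ (Fin D)} (hA : Continuous A) (hx : Continuous x) :
    Continuous fun t ↦ act (A t) (x t) := by
  unfold act
  fun_prop

/-- The numerator of `secondDerivTerm`. -/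
noncomputable def gramDefect (Q Δ : Matrix (Fin D) (Fin D) ℝ) (x : EuclideanSpace ℝ (Fin D)) : ℝ :=
  ‖act Δ x‖ ^ 2 * ‖act Q x‖ ^ 2 - inner ℝ x (act (Δ * Q) x) ^ 2

lemma continuous_gramDefect {T : Type*} [TopologicalSpace T]
    {Q Δ : T → Matrix (Fin D) (Fin D) ℝ} {x : T → EuclideanSpace ℝ (Fin D)}
    (hQ : Continuous Q) (hΔ : Continuous Δ) (hx : Continuous x) :
    Continuous fun t ↦ gramDefect (Q t) (Δ t) (x t) :=
  (((continuous_act hΔ hx).norm.pow 2).mul ((continuous_act hQ hx).norm.pow 2)).sub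
    ((hx.inner (continuous_act (hΔ.matrix_mul hQ) hx)).pow 2)

lemma inner_act_mul {Q Δ : Matrix (Fin D) (Fin D) ℝ} (hΔ : Δ.IsSymm)
    (x : EuclideanSpace ℝ (Fin D)) :
    inner ℝ x (act (Δ * Q) x) = inner ℝ (act Δ x) (act Q x) := by
  rw [act_mul, inner_act_left hΔ]

lemma gramDefect_nonneg {Q Δ : Matrix (Fin D) (Fin D) ℝ} (hΔ : Δ.IsSymm)
    (x : EuclideanSpace ℝ (Fin D)) : 0 ≤ gramDefect Q Δ x := by
  rw [gramDefect, inner_act_mul hΔ, ← mul_pow, sub_nonneg, sq_le_sq,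
    abs_of_nonneg (a := ‖act Δ x‖ * ‖act Q x‖) (by positivity)]
  exact abs_real_inner_le_norm _ _

lemma exists_smul_of_gramDefect_eq_zero {Q Δ : Matrix (Fin D) (Fin D) ℝ} (hΔ : Δ.IsSymm)
    {x : EuclideanSpace ℝ (Fin D)} (h : gramDefect Q Δ x = 0) (hx : act Q x ≠ 0) :
    ∃ c : ℝ, act Δ x = c • act Q x := by
  by_cases h0 : act Δ x = 0
  · exact ⟨0, by simp [h0]⟩
  rw [gramDefect, inner_act_mul hΔ, ← mul_pow, sub_eq_zero, sq_eq_sq_iff_abs_eq_abs,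
    abs_of_nonneg (a := ‖act Δ x‖ * ‖act Q x‖) (by positivity), ← Real.norm_eq_abs,
    real_inner_comm, mul_comm] at h
  obtain ⟨c, -, hc⟩ := (norm_inner_eq_norm_iff (𝕜 := ℝ) hx h0).1 h.symm
  exact ⟨c, hc⟩

lemma act_eq_zero_of_inner_eq_zero {Q : Matrix (Fin D) (Fin D) ℝ} (hQ : Q.PosSemidef)
    {x : EuclideanSpace ℝ (Fin D)} (h : inner ℝ x (act Q x) = 0) : act Q x = 0 := by
  have h' : star x.ofLp ⬝ᵥ Q.mulVec x.ofLp = 0 := by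
    simpa [act, EuclideanSpace.inner_eq_star_dotProduct, dotProduct_comm] using h
  simp [act, (hQ.dotProduct_mulVec_zero_iff _).1 h']

/-- The vectors at which the Gram determinant of `Qx` and `Δx` vanishes lie in the union of two
proper subspaces: if `Δu = cQu ≠ 0` for such a vector `u`, then every other such vector is either
`Q`-orthogonal to `u` or in the kernel of `Δ - cQ`. -/
lemma exists_submodules_of_gramDefect {Q Δ : Matrix (Fin D) (Fin D) ℝ} (hQ : Q ∈ H₁ D)
    (hΔ : Δ.IsSymm) (htr : Δ.trace = 0) (hΔ0 : Δ ≠ 0) :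
    ∃ A B : Submodule ℝ (EuclideanSpace ℝ (Fin D)), A ≠ ⊤ ∧ B ≠ ⊤ ∧
      ∀ x, gramDefect Q Δ x = 0 → x ∈ A ∨ x ∈ B := by
  obtain ⟨⟨hQs, hQt⟩, hQp⟩ := hQ
  by_cases hu : ∃ u, gramDefect Q Δ u = 0 ∧ act Q u ≠ 0
  · obtain ⟨u, hu, hu0⟩ := hu
    obtain ⟨c, hc⟩ := exists_smul_of_gramDefect_eq_zero hΔ hu hu0
    refine ⟨(innerₛₗ ℝ (act Q u)).ker,
      (Matrix.toEuclideanCLM (n := Fin D) (𝕜 := ℝ) Δ -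
        c • Matrix.toEuclideanCLM (n := Fin D) (𝕜 := ℝ) Q).ker, fun h ↦ hu0 ?_, fun h ↦ ?_,
      fun x hx ↦ ?_⟩
    · have : u ∈ (innerₛₗ ℝ (act Q u)).ker := h ▸ Submodule.mem_top
      rw [LinearMap.mem_ker, innerₛₗ_apply_apply, inner_act_left hQs] at this
      exact act_eq_zero_of_inner_eq_zero hQp this
    -- If the kernel is everything, then `Δ = c • Q`, and the traces 0 and 1 force `c = 0`.
    · have hE : Δ = c • Q := by
        refine eq_of_act_eq fun x ↦ ?_
        rw [smul_act]
        have hx : x ∈ (Matrix.toEuclideanCLM (n := Fin D) (𝕜 := ℝ) Δ -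
          c • Matrix.toEuclideanCLM (n := Fin D) (𝕜 := ℝ) Q).ker := h ▸ Submodule.mem_top
        exact sub_eq_zero.1 hx
      have hc0 : c = 0 := by simpa [hE, Matrix.trace_smul, hQt] using htr
      exact hΔ0 (by simp [hE, hc0])
    · simp only [LinearMap.mem_ker, innerₛₗ_apply_apply]
      by_cases hx0 : act Q x = 0
      · left
        rw [inner_act_left hQs, hx0, inner_zero_right]
      obtain ⟨d, hd⟩ := exists_smul_of_gramDefect_eq_zero hΔ hx hx0
      by_cases hcd : d = c
      · right
        subst hcd
        exact sub_eq_zero.2 hd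
      · left
        -- Generalized eigenvectors for distinct eigenvalues `c`, `d` are `Q`-orthogonal, by
        -- symmetry of `Δ` and `Q`.
        have h1 : inner ℝ (act Δ u) x = inner ℝ u (act Δ x) := inner_act_left hΔ u x
        rw [hc, hd, real_inner_smul_left, real_inner_smul_right, ← inner_act_left hQs] at h1
        have h2 : (c - d) * inner ℝ (act Q u) x = 0 := by rw [sub_mul, h1, sub_self]
        exact (mul_eq_zero.1 h2).resolve_left (sub_ne_zero.2 (Ne.symm hcd))
  -- Here the zero set lies in the kernel of `Q`, which is proper since `Q` has trace 1.
  · push Not at hu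
    have hne : (Matrix.toEuclideanCLM (n := Fin D) (𝕜 := ℝ) Q).ker ≠ ⊤ := fun h ↦ by
      have hE : Q = 0 := by
        refine eq_of_act_eq fun x ↦ ?_
        rw [zero_act]
        have hx : x ∈ (Matrix.toEuclideanCLM (n := Fin D) (𝕜 := ℝ) Q).ker :=
          h ▸ Submodule.mem_top
        exact hx
      simp [hE] at hQt
    exact ⟨_, _, hne, hne, fun x hx ↦ .inl (hu x hx)⟩

/-! ### Hyperplanes and the hypothesis on μ -/

lemma exists_le_hyperplane {E : Type*} [AddCommGroup E] [Module ℝ E] [FiniteDimensional ℝ E]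
    {A : Submodule ℝ E} (hA : A ≠ ⊤) :
    ∃ L : Submodule ℝ E, A ≤ L ∧ Module.finrank ℝ L + 1 = Module.finrank ℝ E := by
  obtain ⟨f, hf, hA⟩ := A.exists_le_ker_of_lt_top hA.lt_top
  exact ⟨_, hA, Module.Dual.finrank_ker_add_one_of_ne_zero hf⟩

lemma exists_hyperplane_ne {E : Type*} [AddCommGroup E] [Module ℝ E] [FiniteDimensional ℝ E]
    {L : Submodule ℝ E} (hL : L ≠ ⊥) :
    ∃ L' : Submodule ℝ E, L' ≠ L ∧ Module.finrank ℝ L' + 1 = Module.finrank ℝ E := by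
  obtain ⟨w, hw, hw0⟩ := L.exists_mem_ne_zero_of_ne_bot hL
  obtain ⟨f, hf, -⟩ := (⊥ : Submodule ℝ E).exists_le_ker_of_notMem (v := w) (by simpa using hw0)
  refine ⟨f.ker, fun h ↦ hf ?_, Module.Dual.finrank_ker_add_one_of_ne_zero ?_⟩
  · rw [← h] at hw
    exact hw
  · rintro rfl
    simp at hf

/-- Enlarge both subspaces to hyperplanes. If these coincide, any other hyperplane serves as the
second one; it exists because `2 ≤ D` makes a hyperplane nonzero. -/
lemma not_ae_mem_or_mem (hD : 2 ≤ D)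
    {μ : Measure (EuclideanSpace ℝ (Fin D))} [IsProbabilityMeasure μ]
    (hμ : ∀ L₁ L₂ : Submodule ℝ (EuclideanSpace ℝ (Fin D)),
      Module.finrank ℝ L₁ + 1 = D → Module.finrank ℝ L₂ + 1 = D → L₁ ≠ L₂ →
        μ (L₁ : Set (EuclideanSpace ℝ (Fin D))) + μ (L₂ : Set (EuclideanSpace ℝ (Fin D))) < 1)
    {A B : Submodule ℝ (EuclideanSpace ℝ (Fin D))} (hA : A ≠ ⊤) (hB : B ≠ ⊤) :
    ¬ ∀ᵐ x ∂μ, x ∈ A ∨ x ∈ B := by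
  intro h
  have key : ∀ L₁ L₂ : Submodule ℝ (EuclideanSpace ℝ (Fin D)),
      Module.finrank ℝ L₁ + 1 = D → Module.finrank ℝ L₂ + 1 = D → L₁ ≠ L₂ →
      A ≤ L₁ → (B ≤ L₁ ∨ B ≤ L₂) → False := by
    intro L₁ L₂ h₁ h₂ hne hA hB
    have : μ ((L₁ : Set (EuclideanSpace ℝ (Fin D))) ∪ L₂) = 1 := by
      rw [← mem_ae_iff_prob_eq_one₀
        (L₁.closed_of_finiteDimensional.measurableSet.union
          L₂.closed_of_finiteDimensional.measurableSet).nullMeasurableSet]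
      filter_upwards [h] with x hx
      rcases hx with hx | hx
      · exact .inl (hA hx)
      · exact hB.imp (fun h ↦ h hx) (fun h ↦ h hx)
    exact absurd (this ▸ measure_union_le _ _) (not_le.2 (hμ L₁ L₂ h₁ h₂ hne))
  obtain ⟨L₁, hA₁, h₁⟩ := exists_le_hyperplane hA
  obtain ⟨L₂, hB₂, h₂⟩ := exists_le_hyperplane hB
  rw [finrank_euclideanSpace_fin] at h₁ h₂
  by_cases hne : L₁ = L₂
  · have hbot : L₁ ≠ ⊥ := by
      rintro rfl
      rw [finrank_bot] at h₁
      omega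
    obtain ⟨L, hL, h₃⟩ := exists_hyperplane_ne hbot
    rw [finrank_euclideanSpace_fin] at h₃
    exact key L₁ L h₁ h₃ hL.symm hA₁ (.inl (hne ▸ hB₂))
  · exact key L₁ L₂ h₁ h₂ hne hA₁ (.inr hB₂)

/-! ### Compactness of the feasible set and the two norms -/

lemma abs_apply_le_one_of_mem_H₁ {Q : Matrix (Fin D) (Fin D) ℝ} (hQ : Q ∈ H₁ D) (i j : Fin D) :
    |Q i j| ≤ 1 := by
  obtain ⟨⟨hQs, hQt⟩, hQp⟩ := hQ
  have hd : ∀ i, Q i i ≤ 1 := fun i ↦ hQt ▸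
    Finset.single_le_sum (f := fun i ↦ Q i i) (fun i _ ↦ hQp.diag_nonneg) (Finset.mem_univ i)
  -- Testing positivity on `eᵢ ± eⱼ` gives `2|Q i j| ≤ Q i i + Q j j`.
  have hq : ∀ s : ℝ, s * s = 1 → 0 ≤ Q i i + Q j j + 2 * s * Q i j := fun s hs ↦ by
    have h := hQp.dotProduct_mulVec_nonneg (Pi.single i 1 + s • Pi.single j 1)
    simp only [star_trivial, Matrix.mulVec_add, Matrix.mulVec_smul, Matrix.mulVec_single_one,
      dotProduct_add, add_dotProduct, smul_dotProduct, dotProduct_smul, single_one_dotProduct,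
      Matrix.col_apply, smul_eq_mul, hQs.apply i j] at h
    linear_combination h + Q j j * hs
  rw [abs_le]
  constructor <;> linarith [hq 1 (by norm_num), hq (-1) (by norm_num), hd i, hd j]

lemma isClosed_H₁ : IsClosed (H₁ D) := by
  have h : H₁ D = {Q | Q.transpose = Q} ∩ {Q | Q.trace = 1} ∩
      ⋂ x : Fin D → ℝ, {Q | 0 ≤ x ⬝ᵥ Q.mulVec x} := by
    ext Q
    simp only [H₁, H, Matrix.posSemidef_iff_dotProduct_mulVec, Set.mem_inter_iff, Set.mem_iInter,
      Set.mem_ofPred_eq, star_trivial]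
    exact ⟨fun h ↦ ⟨h.1, h.2.2⟩, fun h ↦ ⟨h.1, h.1.1, h.2⟩⟩
  rw [h]
  refine ((isClosed_eq (by fun_prop) continuous_id).inter
    (isClosed_eq (by fun_prop) continuous_const)).inter
    (isClosed_iInter fun x ↦ isClosed_le continuous_const (by fun_prop))

lemma isCompact_feasible {nrm : Matrix (Fin D) (Fin D) ℝ → ℝ} (hc : Continuous nrm)
    (hb : ∀ A i j, |A i j| ≤ nrm A) : IsCompact (feasible (D := D) nrm) := by
  have hK : IsCompact {A : Matrix (Fin D) (Fin D) ℝ | ∀ i j, A i j ∈ Set.Icc (-1 : ℝ) 1} :=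
    isCompact_pi_infinite fun _ ↦ isCompact_pi_infinite fun _ ↦ isCompact_Icc
  refine (hK.prod hK).of_isClosed_subset ?_ ?_
  · refine (isClosed_H₁.preimage continuous_fst).inter ((IsClosed.preimage continuous_snd
      (isClosed_eq (f := Matrix.transpose) (by fun_prop) continuous_id)).inter
      ((isClosed_eq (hc.comp continuous_snd) continuous_const).inter
      (isClosed_eq (by fun_prop) continuous_const)))
  · rintro ⟨Q, Δ⟩ ⟨hQ, -, hΔ, -⟩
    exact ⟨fun i j ↦ abs_le.1 (abs_apply_le_one_of_mem_H₁ hQ i j),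
      fun i j ↦ abs_le.1 (hΔ ▸ hb Δ i j)⟩

/-- Needed because a real `sInf` over the empty set is 0. The direction is a multiple of `diag(1,
-1, 0, …)`. -/
lemma feasible_nonempty (hD : 2 ≤ D) {nrm : Matrix (Fin D) (Fin D) ℝ → ℝ}
    (hs : ∀ (c : ℝ) A, nrm (c • A) = |c| * nrm A)
    (hb : ∀ A i j, |A i j| ≤ nrm A) : (feasible (D := D) nrm).Nonempty := by
  obtain ⟨D, rfl⟩ := Nat.exists_eq_add_of_le' hD
  have h01 : (0 : Fin (D + 2)) ≠ 1 := by simp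
  set E : Matrix (Fin (D + 2)) (Fin (D + 2)) ℝ :=
    Matrix.diagonal (Pi.single 0 1 - Pi.single 1 1) with hE
  have hpos : 0 < nrm E := lt_of_lt_of_le (by simp [hE, h01]) (hb E 0 0)
  refine ⟨(Matrix.diagonal (Pi.single 0 1), (nrm E)⁻¹ • E),
    ⟨⟨Matrix.diagonal_transpose _, ?_⟩, ?_⟩, ?_, ?_, ?_⟩
  · simp [Matrix.trace_diagonal]
  · exact Matrix.PosSemidef.diagonal (Pi.single_nonneg.2 zero_le_one)
  · exact Matrix.IsSymm.smul (Matrix.diagonal_transpose _) _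
  · rw [hs, abs_of_pos (inv_pos.2 hpos), inv_mul_cancel₀ hpos.ne']
  · simp [hE, Matrix.trace_smul, Matrix.trace_diagonal]

lemma continuous_frobeniusNorm : Continuous (frobeniusNorm (D := D)) := by
  unfold frobeniusNorm
  fun_prop

lemma abs_apply_le_frobeniusNorm (A : Matrix (Fin D) (Fin D) ℝ) (i j : Fin D) :
    |A i j| ≤ frobeniusNorm A := by
  refine Real.abs_le_sqrt ?_
  calc A i j ^ 2 ≤ ∑ j, A i j ^ 2 :=
        Finset.single_le_sum (f := fun j ↦ A i j ^ 2) (fun _ _ ↦ sq_nonneg _) (Finset.mem_univ j)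
    _ ≤ ∑ i, ∑ j, A i j ^ 2 := Finset.single_le_sum (f := fun i ↦ ∑ j, A i j ^ 2)
        (fun _ _ ↦ Finset.sum_nonneg fun _ _ ↦ sq_nonneg _) (Finset.mem_univ i)

lemma frobeniusNorm_smul (c : ℝ) (A : Matrix (Fin D) (Fin D) ℝ) :
    frobeniusNorm (c • A) = |c| * frobeniusNorm A := by
  simp only [frobeniusNorm, Matrix.smul_apply, smul_eq_mul, mul_pow, ← Finset.mul_sum]
  rw [Real.sqrt_mul (sq_nonneg c), Real.sqrt_sq_eq_abs]

lemma toEuclideanCLM_smul (c : ℝ) (A : Matrix (Fin D) (Fin D) ℝ) :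
    Matrix.toEuclideanCLM (n := Fin D) (𝕜 := ℝ) (c • A) =
      c • Matrix.toEuclideanCLM (n := Fin D) (𝕜 := ℝ) A :=
  map_smul (Matrix.toEuclideanCLM (n := Fin D) (𝕜 := ℝ)).toAlgEquiv c A

lemma continuous_spectralNorm : Continuous (spectralNorm (D := D)) :=
  (LinearMap.continuous_of_finiteDimensional
    (Matrix.toEuclideanCLM (n := Fin D) (𝕜 := ℝ)).toAlgEquiv.toLinearMap).norm

lemma abs_apply_le_spectralNorm (A : Matrix (Fin D) (Fin D) ℝ) (i j : Fin D) :
    |A i j| ≤ spectralNorm A := by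
  have h1 := (Matrix.toEuclideanCLM (n := Fin D) (𝕜 := ℝ) A).le_opNorm
    (EuclideanSpace.single j (1 : ℝ))
  have h2 := PiLp.norm_apply_le (p := 2) (Matrix.toEuclideanCLM (n := Fin D) (𝕜 := ℝ) A
    (EuclideanSpace.single j (1 : ℝ))) i
  rw [PiLp.norm_single, norm_one, mul_one] at h1
  refine le_trans (le_of_eq ?_) (h2.trans h1)
  simp [Matrix.ofLp_toEuclideanCLM]

lemma spectralNorm_smul (c : ℝ) (A : Matrix (Fin D) (Fin D) ℝ) :
    spectralNorm (c • A) = |c| * spectralNorm A := by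
  rw [spectralNorm, toEuclideanCLM_smul, norm_smul, Real.norm_eq_abs, spectralNorm]

end GMS

/-! ### Uniform law of large numbers -/

/-- A one-sided uniform law of large numbers: if `f q` has positive mean for all `q` in a compact
set, then almost surely the empirical means are eventually bounded below by a positive constant,
uniformly over this set. -/
theorem exists_pos_forall_ae_eventually_le_average {T E : Type*} [TopologicalSpace T]
    [TopologicalSpace E] [MeasurableSpace E] [BorelSpace E]
    {μ : Measure E} [IsProbabilityMeasure μ] {B : Set E} (hB : IsCompact B)
    (hμB : ∀ᵐ x ∂μ, x ∈ B) {f : T → E → ℝ} (hf : Continuous fun p : T × E ↦ f p.1 p.2)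
    {K : Set T} (hK : IsCompact K) (hpos : ∀ q ∈ K, 0 < ∫ x, f q x ∂μ) :
    ∃ c : ℝ, 0 < c ∧ ∀ (Ω : Type*) [MeasurableSpace Ω] (P : Measure Ω) [IsProbabilityMeasure P]
      (X : ℕ → Ω → E), (∀ i, HasLaw (X i) μ P) → iIndepFun X P →
        ∀ᵐ ω ∂P, ∀ᶠ N : ℕ in atTop, ∀ q ∈ K, c * N ≤ ∑ i : Fin N, f q (X i ω) := by
  -- Compactness reduces to a neighbourhood of each point. As `c` is chosen before `Ω`, it depends
  -- on μ but not on the sample.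
  refine hK.induction_on (p := fun s ↦ ∃ c : ℝ, 0 < c ∧ ∀ (Ω : Type _) [MeasurableSpace Ω]
    (P : Measure Ω) [IsProbabilityMeasure P] (X : ℕ → Ω → E), (∀ i, HasLaw (X i) μ P) →
    iIndepFun X P → ∀ᵐ ω ∂P, ∀ᶠ N : ℕ in atTop, ∀ q ∈ s, c * N ≤ ∑ i : Fin N, f q (X i ω))
    ⟨1, one_pos, by simp⟩ ?_ ?_ ?_
  · rintro s t hst ⟨c, hc, h⟩
    refine ⟨c, hc, fun Ω _ P _ X hX hI ↦ ?_⟩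
    filter_upwards [h Ω P X hX hI] with ω hω
    filter_upwards [hω] with N hN q hq using hN q (hst hq)
  · rintro s t ⟨c, hc, h⟩ ⟨d, hd, h'⟩
    refine ⟨min c d, lt_min hc hd, fun Ω _ P _ X hX hI ↦ ?_⟩
    filter_upwards [h Ω P X hX hI, h' Ω P X hX hI] with ω hω hω'
    filter_upwards [hω, hω'] with N hN hN' q hq
    rcases hq with hq | hq
    · exact (mul_le_mul_of_nonneg_right (min_le_left _ _) N.cast_nonneg).trans (hN q hq)
    · exact (mul_le_mul_of_nonneg_right (min_le_right _ _) N.cast_nonneg).trans (hN' q hq)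
  · intro p hp
    set m := ∫ x, f p x ∂μ with hm
    have hm0 : 0 < m := hpos p hp
    have hfp : ∀ q, Continuous (f q) := fun q ↦ hf.comp (by fun_prop : Continuous fun x ↦ (q, x))
    -- For `q` near `p`, replacing `f p` by `f q` costs at most `m / 3`, uniformly on `B`; the
    -- averages of `f p` eventually exceed `2 * m / 3`.
    obtain ⟨U, V, hU, -, hpU, hBV, hUV⟩ := generalized_tube_lemma (isCompact_singleton (x := p)) hB
      (n := {r : T × E | f p r.2 - m / 3 < f r.1 r.2})
      (isOpen_lt (((hfp p).comp continuous_snd).sub continuous_const) hf) (by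
        rintro ⟨q, x⟩ ⟨rfl, -⟩
        simpa using hm0)
    refine ⟨U, mem_nhdsWithin_of_mem_nhds (hU.mem_nhds (hpU rfl)), m / 3, by positivity,
      fun Ω _ P _ X hX hI ↦ ?_⟩
    have hint : Integrable (f p) μ := by
      obtain ⟨C, hC⟩ := hB.exists_bound_of_continuousOn (hfp p).continuousOn
      exact Integrable.of_bound (hfp p).measurable.aestronglyMeasurable C
        (hμB.mono fun x hx ↦ hC x hx)
    have hlaw : ∀ i, IdentDistrib (f p ∘ X i) (f p ∘ X 0) P P := fun i ↦
      ((hX i).identDistrib (hX 0)).comp (hfp p).measurable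
    have hlln := strong_law_ae_real (fun i ↦ f p ∘ X i)
      (((hX 0).map_eq.symm ▸ hint).comp_aemeasurable (hX 0).aemeasurable)
      (fun i j hij ↦ (hI.indepFun hij).comp (hfp p).measurable (hfp p).measurable) hlaw
    rw [show P[f p ∘ X 0] = m from (hX 0).integral_comp hint.1] at hlln
    have hB' : ∀ᵐ ω ∂P, ∀ i, X i ω ∈ B := ae_all_iff.2 fun i ↦
      ae_of_ae_map (hX i).aemeasurable ((hX i).map_eq.symm ▸ hμB)
    filter_upwards [hlln, hB'] with ω hω hωB
    filter_upwards [hω.eventually_const_lt (show 2 * m / 3 < m by linarith),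
      eventually_gt_atTop 0] with N hN hN0 q hq
    rw [lt_div_iff₀ (by exact_mod_cast hN0), Finset.sum_range] at hN
    calc m / 3 * N = 2 * m / 3 * N - N * (m / 3) := by ring
      _ ≤ ∑ i : Fin N, f p (X i ω) - N * (m / 3) := by gcongr; exact hN.le
      _ = ∑ i : Fin N, (f p (X i ω) - m / 3) := by simp
      _ ≤ _ := Finset.sum_le_sum fun i _ ↦ (hUV (a := (q, X i ω)) ⟨hq, hBV (hωB i)⟩).le

namespace GMS

variable {D : ℕ}

/-! ### Positive mean and the bound on the liminf -/

lemma integral_gramDefect_pos (hD : 2 ≤ D)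
    {μ : Measure (EuclideanSpace ℝ (Fin D))} [IsProbabilityMeasure μ]
    {R : ℝ} (hR : ∀ᵐ x ∂μ, ‖x‖ ≤ R)
    (hμ : ∀ L₁ L₂ : Submodule ℝ (EuclideanSpace ℝ (Fin D)),
      Module.finrank ℝ L₁ + 1 = D → Module.finrank ℝ L₂ + 1 = D → L₁ ≠ L₂ →
        μ (L₁ : Set (EuclideanSpace ℝ (Fin D))) + μ (L₂ : Set (EuclideanSpace ℝ (Fin D))) < 1)
    {Q Δ : Matrix (Fin D) (Fin D) ℝ} (hQ : Q ∈ H₁ D)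
    (hΔ : Δ.IsSymm) (htr : Δ.trace = 0) (hΔ0 : Δ ≠ 0) :
    0 < ∫ x, gramDefect Q Δ x ∂μ := by
  have hc : Continuous (gramDefect Q Δ) :=
    continuous_gramDefect continuous_const continuous_const continuous_id
  have h0 : ∀ x, 0 ≤ gramDefect Q Δ x := gramDefect_nonneg hΔ
  refine (integral_nonneg h0).lt_of_ne fun h ↦ ?_
  have hint : Integrable (gramDefect Q Δ) μ := by
    obtain ⟨C, hC⟩ := (isCompact_closedBall (0 : EuclideanSpace ℝ (Fin D))
      R).exists_bound_of_continuousOn (f := gramDefect Q Δ) hc.continuousOn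
    refine Integrable.of_bound hc.aestronglyMeasurable C ?_
    filter_upwards [hR] with x hx
    exact hC x (mem_closedBall_zero_iff.2 hx)
  obtain ⟨A, B, hA, hB, hAB⟩ := exists_submodules_of_gramDefect hQ hΔ htr hΔ0
  refine not_ae_mem_or_mem hD hμ hA hB ?_
  filter_upwards [(integral_eq_zero_iff_of_nonneg h0 hint).1 h.symm] with x hx using hAB x hx

lemma gramDefect_div_le_secondDerivTerm {Q Δ : Matrix (Fin D) (Fin D) ℝ} (hΔ : Δ.IsSymm)
    {x : EuclideanSpace ℝ (Fin D)} {M : ℝ} (hx : ‖act Q x‖ ≤ M) :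
    gramDefect Q Δ x / M ^ 3 ≤ secondDerivTerm Q Δ x := by
  have h0 := gramDefect_nonneg (Q := Q) hΔ x
  rw [secondDerivTerm, ← gramDefect]
  rcases (norm_nonneg (act Q x)).eq_or_lt with hz | hz
  -- At `Qx = 0` both sides vanish.
  · have h : gramDefect Q Δ x = 0 := by
      rw [gramDefect, inner_act_mul hΔ, norm_eq_zero.1 hz.symm]
      simp
    simp [h]
  · exact div_le_div_of_nonneg_left h0 (by positivity) (by gcongr)

theorem exists_pos_le_liminf_rscConstant (hD : 2 ≤ D)
    {μ : Measure (EuclideanSpace ℝ (Fin D))} [IsProbabilityMeasure μ]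
    {R : ℝ} (hR : ∀ᵐ x ∂μ, ‖x‖ ≤ R)
    (hμ : ∀ L₁ L₂ : Submodule ℝ (EuclideanSpace ℝ (Fin D)),
      Module.finrank ℝ L₁ + 1 = D → Module.finrank ℝ L₂ + 1 = D → L₁ ≠ L₂ →
        μ (L₁ : Set (EuclideanSpace ℝ (Fin D))) + μ (L₂ : Set (EuclideanSpace ℝ (Fin D))) < 1)
    {nrm : Matrix (Fin D) (Fin D) ℝ → ℝ} (hc : Continuous nrm)
    (hs : ∀ (c : ℝ) A, nrm (c • A) = |c| * nrm A) (hb : ∀ A i j, |A i j| ≤ nrm A) :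
    ∃ c : ℝ, 0 < c ∧ ∀ (Ω : Type*) [MeasurableSpace Ω] (P : Measure Ω) [IsProbabilityMeasure P]
      (X : ℕ → Ω → EuclideanSpace ℝ (Fin D)), (∀ i, HasLaw (X i) μ P) → iIndepFun X P →
        ∀ᵐ ω ∂P, (c : EReal) ≤ liminf
          (fun N : ℕ ↦ ((rscConstant nrm (fun i : Fin N ↦ X i ω) : ℝ) : EReal)) atTop := by
  have hK := isCompact_feasible hc hb
  have hball := isCompact_closedBall (0 : EuclideanSpace ℝ (Fin D)) R
  obtain ⟨M, hM⟩ := (hK.prod hball).exists_bound_of_continuousOn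
    (continuous_act (continuous_fst.comp continuous_fst) continuous_snd).continuousOn
  obtain ⟨c, hc0, hc⟩ := exists_pos_forall_ae_eventually_le_average
    (f := fun p x ↦ gramDefect p.1 p.2 x) hball
    (hR.mono fun x hx ↦ mem_closedBall_zero_iff.2 hx)
    (continuous_gramDefect (continuous_fst.comp continuous_fst)
      (continuous_snd.comp continuous_fst) continuous_snd) hK (by
      rintro ⟨Q, Δ⟩ ⟨hQ, hΔ, hn, htr⟩
      refine integral_gramDefect_pos hD hR hμ hQ hΔ htr ?_
      rintro rfl
      have := hs 0 0
      simp [hn] at this)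
  -- `M` itself need not be positive.
  have hM0 : 0 < max M 1 := by positivity
  refine ⟨c / max M 1 ^ 3, by positivity, fun Ω _ P _ X hX hI ↦ ?_⟩
  have hR' : ∀ᵐ ω ∂P, ∀ i, ‖X i ω‖ ≤ R := ae_all_iff.2 fun i ↦
    ae_of_ae_map (hX i).aemeasurable ((hX i).map_eq.symm ▸ hR)
  filter_upwards [hc Ω P X hX hI, hR'] with ω hω hωR
  refine le_liminf_of_le (by isBoundedDefault) ?_
  filter_upwards [hω, eventually_gt_atTop 0] with N hN hN0
  have hN' : (0 : ℝ) < N := by exact_mod_cast hN0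
  rw [EReal.coe_le_coe_iff, rscConstant, one_div, inv_mul_eq_div, le_div_iff₀ hN']
  refine le_csInf ((feasible_nonempty hD hs hb).image _) ?_
  rintro _ ⟨⟨Q, Δ⟩, hp, rfl⟩
  have hsum : c * N ≤ ∑ i : Fin N, gramDefect Q Δ (X i ω) := hN (Q, Δ) hp
  have hterm : ∀ i : Fin N, gramDefect Q Δ (X i ω) / max M 1 ^ 3 ≤ secondDerivTerm Q Δ (X i ω) :=
    fun i ↦ gramDefect_div_le_secondDerivTerm hp.2.1
      ((hM ((Q, Δ), X i ω) ⟨hp, mem_closedBall_zero_iff.2 (hωR i)⟩).trans (le_max_left _ _))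
  rw [div_mul_eq_mul_div]
  refine (div_le_div_of_nonneg_right hsum (by positivity)).trans ?_
  rw [Finset.sum_div]
  exact Finset.sum_le_sum fun i _ ↦ hterm i

end GMS

theorem mainTheorem12 {D : ℕ} (hD : 2 ≤ D)
    (μ : Measure (EuclideanSpace ℝ (Fin D))) [IsProbabilityMeasure μ]
    (hbdd : ∃ R : ℝ, ∀ᵐ x ∂μ, ‖x‖ ≤ R)
    (hμ : ∀ L₁ L₂ : Submodule ℝ (EuclideanSpace ℝ (Fin D)),
      Module.finrank ℝ L₁ + 1 = D → Module.finrank ℝ L₂ + 1 = D → L₁ ≠ L₂ →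
        μ (L₁ : Set (EuclideanSpace ℝ (Fin D))) + μ (L₂ : Set (EuclideanSpace ℝ (Fin D))) < 1) :
    ∃ c₀ c₀' : ℝ, 0 < c₀ ∧ 0 < c₀' ∧
      ∀ (Ω : Type*) [MeasurableSpace Ω] (P : Measure Ω) [IsProbabilityMeasure P]
        (X : ℕ → Ω → EuclideanSpace ℝ (Fin D)),
        (∀ i, HasLaw (X i) μ P) → iIndepFun X P →
          ∀ᵐ ω ∂P,
            (c₀ : EReal) ≤ liminf
              (fun N : ℕ => ((GMS.γ₀ (fun i : Fin N => X i ω) : ℝ) : EReal)) atTop ∧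
            (c₀' : EReal) ≤ liminf
              (fun N : ℕ => ((GMS.γ₀' (fun i : Fin N => X i ω) : ℝ) : EReal)) atTop := by
  obtain ⟨R, hR⟩ := hbdd
  obtain ⟨c, hc, h⟩ := GMS.exists_pos_le_liminf_rscConstant hD hR hμ
    GMS.continuous_frobeniusNorm GMS.frobeniusNorm_smul GMS.abs_apply_le_frobeniusNorm
  obtain ⟨c', hc', h'⟩ := GMS.exists_pos_le_liminf_rscConstant hD hR hμ
    GMS.continuous_spectralNorm GMS.spectralNorm_smul GMS.abs_apply_le_spectralNorm
  refine ⟨c, c', hc, hc', fun Ω _ P _ X hX hI ↦ ?_⟩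
  filter_upwards [h Ω P X hX hI, h' Ω P X hX hI] with ω hω hω' using ⟨hω, hω'⟩
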